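/- Let $\Omega\subset\mathbb R^n$ be a bounded domain (open and connected), let $D_u,D_v>0$, and consider $$u_t=D_u\Delta u+f(u,v),\qquad v_t=D_v\Delta v+g(u,v)\qquad\text{in }\Omega,$$ near a homogeneous steady state $(u_0,v_0)$, $f(u_0,v_0)=g(u_0,v_0)=0$, where $f,g:\mathbb R^2\to\mathbb R$ are differentiable at $(u_0,v_0)$, and where the perturbation $(u-u_0,v-v_0)$ satisfies either the homogeneous Dirichlet or the homogeneous Neumann boundary condition on $\partial\Omega$. Let $$A=\begin{pmatrix}a_{11}&a_{12}\\a_{21}&a_{22}\end{pmatrix}=\begin{pmatrix}f_u&f_v\\g_u&g_v\end{pmatrix}(u_0,v_0).$$ Let $H_1$ be the set of complex-valued functions in $H^2(\Omega)$ that satisfy the boundary condition; here Dirichlet means $w\in H^1_0(\Omega)$, and Neumann ($\partial w/\partial n=0$) means $\int_\Omega \Delta w\,\varphi+\int_\Omega\nabla w\cdot\nabla\varphi=0$ for all $\varphi\in H^1(\Omega)$. Eigenvalues of $-\Delta$ are those of $-\Delta:H_1\to L^2(\Omega)$, and the linearization of the system is the operator $$\mathcal L(w,z)=(D_u\Delta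 w+a_{11}w+a_{12}z,\;D_v\Delta z+a_{21}w+a_{22}z),\qquad \mathcal L:H_1\times H_1\to L^2(\Omega)^2 .$$ The system is called *Turing stable* (at $(u_0,v_0)$) if all eigenvalues of $\mathcal L$ have negative real part. It *generates Turing instability* if $(u_0,v_0)$ is linearly stable without diffusion, that is, all eigenvalues of $A$ have negative real part, while $\mathcal L$ has an eigenvalue with positive real part. Assume $\det A>0$ and $\operatorname{Tr}A<0$, and set $$D=D_va_{11}+D_ua_{22},\qquad L=-\frac{\det A}{D_uD_v}+\frac{D^2}{4D_u^2D_v^2}.$$ **Theorem.** (1) If $D\le0$ and $L\le0$, then the system is Turing stable. (2) If $L>0$, then the system generates Turing instability if and only if there is an eigenvalue $\lambda_k$ of $-\Delta$ such that $$\left|\lambda_k-\frac{D}{2D_uD_v}\right|<\sqrt L .$$ -/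

import Mathlib

open MeasureTheory
open scoped ContDiff ENNReal

noncomputable section

namespace TuringSystem

/-- Euclidean space `ℝⁿ`. -/
abbrev Space (n : ℕ) : Type := EuclideanSpace ℝ (Fin n)

/-- The complexified space `L²(Ω)`. -/
abbrev L2 {n : ℕ} (Ω : Set (Space n)) : Type := Lp ℂ 2 (volume.restrict Ω)

/-- The classical partial derivative `∂φ/∂xᵢ`. -/
def partialDeriv {n : ℕ} {F : Type*} [NormedAddCommGroup F] [NormedSpace ℝ F]
    (i : Fin n) (φ : Space n → F) (x : Space n) : F :=
  fderiv ℝ φ x (EuclideanSpace.single i 1)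

/-- Test functions: smooth, with compact support contained in `Ω`. -/
def IsTestFunction {n : ℕ} {F : Type*} [NormedAddCommGroup F] [NormedSpace ℝ F]
    (Ω : Set (Space n)) (φ : Space n → F) : Prop :=
  ContDiff ℝ ∞ φ ∧ HasCompactSupport φ ∧ tsupport φ ⊆ Ω

/-- `g` is the weak partial derivative of `u` on `Ω` in the `i`-th direction. -/
def HasWeakPartial {n : ℕ} {Ω : Set (Space n)} (i : Fin n) (u g : L2 Ω) : Prop :=
  ∀ φ : Space n → ℝ, IsTestFunction Ω φ →
    ∫ x in Ω, partialDeriv i φ x • u x = -∫ x in Ω, φ x • g x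

/-- `u ∈ H¹(Ω)`, with weak gradient `G`. -/
def HasWeakGradient {n : ℕ} {Ω : Set (Space n)} (u : L2 Ω) (G : Fin n → L2 Ω) : Prop :=
  ∀ i, HasWeakPartial i u (G i)

/-- For `u ∈ H¹(Ω)` with weak gradient `G`: `u ∈ H₀¹(Ω)`, the closure of the test functions
in the `H¹` norm. -/
def InH10 {n : ℕ} {Ω : Set (Space n)} (u : L2 Ω) (G : Fin n → L2 Ω) : Prop :=
  ∀ ε : ℝ≥0∞, 0 < ε → ∃ φ : Space n → ℂ, IsTestFunction Ω φ ∧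
    eLpNorm (fun x => φ x - u x) 2 (volume.restrict Ω) < ε ∧
    ∀ i, eLpNorm (fun x => partialDeriv i φ x - G i x) 2 (volume.restrict Ω) < ε

/-- The two homogeneous boundary conditions: zero boundary values, or zero normal derivative. -/
inductive BoundaryCondition
  | dirichlet
  | neumann

/-- The boundary condition for `u ∈ H²(Ω)` with weak gradient `G` and Laplacian `f`.
Dirichlet: `u ∈ H₀¹(Ω)`, that is, `u` has trace zero. Neumann: the boundary term
`∫_{∂Ω} (∂u/∂n) w` in Green's formula, which is `∫_Ω (Δu) w + ∫_Ω ∇u · ∇w`, vanishes for every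
`w ∈ H¹(Ω)`, that is, `∂u/∂n = 0` on `∂Ω`. -/
def BoundaryCondition.Holds {n : ℕ} {Ω : Set (Space n)} (bc : BoundaryCondition)
    (u : L2 Ω) (G : Fin n → L2 Ω) (f : L2 Ω) : Prop :=
  match bc with
  | .dirichlet => InH10 u G
  | .neumann => ∀ (w : L2 Ω) (K : Fin n → L2 Ω), HasWeakGradient w K →
      (∫ x in Ω, f x * w x) + ∑ i, ∫ x in Ω, G i x * K i x = 0

/-- `u ∈ H²(Ω)`, `u` satisfies the boundary condition, and `Δu = f`. -/
def HasLaplacian {n : ℕ} {Ω : Set (Space n)} (bc : BoundaryCondition) (u f : L2 Ω) : Prop :=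
  ∃ (G : Fin n → L2 Ω) (H : Fin n → Fin n → L2 Ω),
    HasWeakGradient u G ∧ (∀ i, HasWeakGradient (G i) (H i)) ∧
    f = ∑ i, H i i ∧ bc.Holds u G f

/-- `l` is an eigenvalue of `-Δ` on `Ω` under the boundary condition `bc`. -/
def IsEigenvalueNegLaplacian {n : ℕ} (Ω : Set (Space n)) (bc : BoundaryCondition) (l : ℝ) :
    Prop :=
  ∃ u Δu : L2 Ω, u ≠ 0 ∧ HasLaplacian bc u Δu ∧ -Δu = (l : ℂ) • u

end TuringSystem

open TuringSystem

/-- The system `u_t = D_u Δu + f(u,v)`, `v_t = D_v Δv + g(u,v)` on a bounded domain `Ω ⊆ ℝⁿ`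
with Dirichlet or Neumann boundary conditions, and a homogeneous steady state `(u₀, v₀)`
(in the Dirichlet case the boundary values are those of the steady state, so that perturbations
of it vanish on the boundary). -/
structure ReactionDiffusionSystem (n : ℕ) where
  Ω : Set (Space n)
  isOpen_Ω : IsOpen Ω
  isConnected_Ω : IsConnected Ω
  isBounded_Ω : Bornology.IsBounded Ω
  bc : BoundaryCondition
  Du : ℝ
  Dv : ℝ
  Du_pos : 0 < Du
  Dv_pos : 0 < Dv
  f : ℝ → ℝ → ℝ
  g : ℝ → ℝ → ℝ
  u₀ : ℝ
  v₀ : ℝ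
  f_steady : f u₀ v₀ = 0
  g_steady : g u₀ v₀ = 0
  differentiableAt_f : DifferentiableAt ℝ (fun p : ℝ × ℝ => f p.1 p.2) (u₀, v₀)
  differentiableAt_g : DifferentiableAt ℝ (fun p : ℝ × ℝ => g p.1 p.2) (u₀, v₀)

namespace ReactionDiffusionSystem

variable {n : ℕ} (S : ReactionDiffusionSystem n)

/-- The Jacobian matrix of the kinetics `(f, g)` at the steady state. -/
def A : Matrix (Fin 2) (Fin 2) ℝ :=
  !![deriv (fun u => S.f u S.v₀) S.u₀, deriv (fun v => S.f S.u₀ v) S.v₀;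
     deriv (fun u => S.g u S.v₀) S.u₀, deriv (fun v => S.g S.u₀ v) S.v₀]

/-- `β` is an eigenvalue of the linearization `(u, v) ↦ (D_u Δu, D_v Δv) + A (u, v)` of the
system at the steady state, acting on pairs of `H²` functions which satisfy the boundary
condition. -/
def IsEigenvalue (β : ℂ) : Prop :=
  ∃ u v Δu Δv : L2 S.Ω, (u ≠ 0 ∨ v ≠ 0) ∧
    HasLaplacian S.bc u Δu ∧ HasLaplacian S.bc v Δv ∧
    (S.Du : ℂ) • Δu + (S.A 0 0 : ℂ) • u + (S.A 0 1 : ℂ) • v = β • u ∧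
    (S.Dv : ℂ) • Δv + (S.A 1 0 : ℂ) • u + (S.A 1 1 : ℂ) • v = β • v

/-- The steady state is (linearly) stable for the system without diffusion
`u' = f(u,v)`, `v' = g(u,v)`: all eigenvalues of the Jacobian have negative real part. -/
def KineticallyStable : Prop :=
  ∀ z : ℂ, Module.End.HasEigenvalue (Matrix.toLin' (S.A.map Complex.ofReal)) z → z.re < 0

/-- Turing stability: all eigenvalues of the linearization of the full system have negative
real part. -/
def TuringStable : Prop :=
  ∀ β : ℂ, S.IsEigenvalue β → β.re < 0

/-- Turing (diffusion-driven) instability: the steady state is stable without diffusion, but the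
linearization of the full system has an eigenvalue with positive real part. -/
def TuringUnstable : Prop :=
  S.KineticallyStable ∧ ∃ β : ℂ, S.IsEigenvalue β ∧ 0 < β.re

end ReactionDiffusionSystem

end

/-
By Green's identity the eigenvalues of `-Δ` are real and nonnegative. The eigenvalue equation of
the linearization, solved for the Laplacians, reads `Δ(u, v) = M (u, v)` with a constant matrix `M`.
So `Δ` acts on the span of `u` and `v` through `M`, and this finite-dimensional picture already
contains an eigenfunction of `Δ`: no spectral decomposition of `L²(Ω)` is needed. Hence the
eigenvalues of the linearization are exactly those of the matrices `A - l diag(D_u, D_v)`, `l` an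
eigenvalue of `-Δ`. These have negative trace, so their stability is decided by the sign of the
determinant, the quadratic `D_u D_v ((l - D / (2 D_u D_v))² - L)` in `l`.
-/

namespace TuringSystem

section LinearAlgebra

open Module.End

theorem exists_hasEigenvalue_map_apply_eq_smul {K V W : Type*} [Field K] [IsAlgClosed K]
    [AddCommGroup V] [Module K V] [AddCommGroup W] [Module K W] [FiniteDimensional K W]
    {T : W →ₗ[K] V} (hT : T ≠ 0) (f : Module.End K W) :
    ∃ μ c, f.HasEigenvalue μ ∧ T c ≠ 0 ∧ T (f c) = μ • T c := by
  obtain ⟨μ, hμ⟩ : ∃ μ, ¬ f.maxGenEigenspace μ ≤ T.ker := by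
    by_contra! h
    exact hT (LinearMap.ker_eq_top.1
      (top_le_iff.1 ((iSup_maxGenEigenspace_eq_top f).ge.trans (iSup_le h))))
  obtain ⟨x, hx, hTx⟩ := SetLike.not_le_iff_exists.1 hμ
  obtain ⟨k, hk⟩ := (mem_maxGenEigenspace f μ x).1 hx
  have hf : f.HasEigenvalue μ := by
    refine HasUnifEigenvalue.lt (k := ⊤) one_pos fun hbot => hTx ?_
    rw [maxGenEigenspace, hbot, Submodule.mem_bot] at hx
    rw [hx]
    exact zero_mem _
  let N := f - μ • (1 : Module.End K W)
  obtain ⟨m, hm, hm'⟩ : ∃ m, T ((N ^ m) x) ≠ 0 ∧ T ((N ^ (m + 1)) x) = 0 :=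
    Nat.exists_not_and_succ_of_not_zero_of_exists hTx ⟨k, by rw [hk, map_zero]⟩
  refine ⟨μ, (N ^ m) x, hf, hm, sub_eq_zero.1 ?_⟩
  rw [pow_succ', mul_apply] at hm'
  simpa [N] using hm'

theorem hasEigenvalue_toLin'_fin_two_iff {K : Type*} [Field K] (M : Matrix (Fin 2) (Fin 2) K)
    (z : K) : HasEigenvalue (Matrix.toLin' M) z ↔ z ^ 2 - M.trace * z + M.det = 0 := by
  rw [Module.End.hasEigenvalue_iff_isRoot_charpoly, Matrix.charpoly_toLin', Matrix.charpoly_fin_two]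
  simp

theorem hasEigenvalue_map_ofReal_iff (M : Matrix (Fin 2) (Fin 2) ℝ) (z : ℂ) :
    HasEigenvalue (Matrix.toLin' (M.map Complex.ofReal)) z ↔ z ^ 2 - M.trace * z + M.det = 0 := by
  rw [hasEigenvalue_toLin'_fin_two_iff]
  simp [Matrix.trace_fin_two, Matrix.det_fin_two]

variable {M : Matrix (Fin 2) (Fin 2) ℝ}

theorem det_eq_of_hasEigenvalue_of_re_nonneg (htr : M.trace < 0) {z : ℂ}
    (hz : HasEigenvalue (Matrix.toLin' (M.map Complex.ofReal)) z) (hre : 0 ≤ z.re) :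
    M.det = z.re * (M.trace - z.re) := by
  rw [hasEigenvalue_map_ofReal_iff] at hz
  have hz_re : z.re ^ 2 - z.im ^ 2 - M.trace * z.re + M.det = 0 := by
    simpa [sq] using congrArg Complex.re hz
  have hz_im : z.re * z.im + z.im * z.re - M.trace * z.im = 0 := by
    simpa [sq] using congrArg Complex.im hz
  have him : z.im = 0 := by
    have hprod : (2 * z.re - M.trace) * z.im = 0 := by linear_combination hz_im
    exact (mul_eq_zero.1 hprod).resolve_left (by linarith)
  rw [him] at hz_re
  linear_combination hz_re

theorem re_neg_of_hasEigenvalue (htr : M.trace < 0) (hdet : 0 < M.det) {z : ℂ}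
    (hz : HasEigenvalue (Matrix.toLin' (M.map Complex.ofReal)) z) : z.re < 0 := by
  by_contra! hre
  have hdet_eq := det_eq_of_hasEigenvalue_of_re_nonneg htr hz hre
  exact hdet.not_ge (hdet_eq.trans_le (mul_nonpos_of_nonneg_of_nonpos hre (by linarith)))

theorem exists_pos_hasEigenvalue_of_det_neg (hdet : M.det < 0) :
    ∃ x : ℝ, 0 < x ∧ HasEigenvalue (Matrix.toLin' (M.map Complex.ofReal)) (x : ℂ) := by
  have hsq := Real.sq_sqrt (show 0 ≤ M.trace ^ 2 - 4 * M.det by nlinarith [sq_nonneg M.trace])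
  have hlt : -M.trace < √(M.trace ^ 2 - 4 * M.det) :=
    Real.lt_sqrt_of_sq_lt (by linarith)
  refine ⟨(M.trace + √(M.trace ^ 2 - 4 * M.det)) / 2, by linarith, ?_⟩
  rw [hasEigenvalue_map_ofReal_iff]
  norm_cast
  linear_combination hsq / 4

theorem exists_hasEigenvalue_re_pos_iff (htr : M.trace < 0) :
    (∃ z : ℂ, HasEigenvalue (Matrix.toLin' (M.map Complex.ofReal)) z ∧ 0 < z.re) ↔ M.det < 0 := by
  constructor
  · rintro ⟨z, hz, hre⟩
    rw [det_eq_of_hasEigenvalue_of_re_nonneg htr hz hre.le]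
    exact mul_neg_of_pos_of_neg hre (by linarith)
  · intro hdet
    obtain ⟨x, hx, hMx⟩ := exists_pos_hasEigenvalue_of_det_neg hdet
    exact ⟨x, hMx, hx⟩

end LinearAlgebra

section L2

variable {α 𝕜 : Type*} [MeasurableSpace α] {μ : Measure α} [RCLike 𝕜]

theorem integral_smul_star (r : α → ℝ) (f : Lp 𝕜 2 μ) :
    ∫ x, r x • (star f : Lp 𝕜 2 μ) x ∂μ = star (∫ x, r x • f x ∂μ) := by
  rw [RCLike.star_def, ← integral_conj]
  refine integral_congr_ae ?_
  filter_upwards [Lp.coeFn_star f] with x hx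
  simp [hx, RCLike.real_smul_eq_coe_mul]

theorem integral_mul_eq_inner_star (f g : Lp 𝕜 2 μ) :
    ∫ x, f x * g x ∂μ = inner 𝕜 (star g) f := by
  rw [L2.inner_def]
  refine integral_congr_ae ?_
  filter_upwards [Lp.coeFn_star g] with x hx
  simp [hx]

theorem inner_eq_integral_smul_of_ae_eq_ofReal {r : α → ℝ} {f : Lp 𝕜 2 μ}
    (hf : f =ᵐ[μ] fun x => (r x : 𝕜)) (g : Lp 𝕜 2 μ) :
    inner 𝕜 f g = ∫ x, r x • g x ∂μ := by
  rw [L2.inner_def]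
  refine integral_congr_ae ?_
  filter_upwards [hf] with x hx
  simp [hx, RCLike.real_smul_eq_coe_mul, mul_comm]

theorem inner_eq_integral_re_sub_I_mul_integral_im (f g : Lp 𝕜 2 μ) :
    inner 𝕜 f g =
      ∫ x, RCLike.re (f x) • g x ∂μ - RCLike.I * ∫ x, RCLike.im (f x) • g x ∂μ := by
  have hre : Integrable (fun x => RCLike.re (f x) • g x) μ :=
    memLp_one_iff_integrable.1 ((Lp.memLp g).smul (Lp.memLp f).re)
  have him : Integrable (fun x => RCLike.im (f x) • g x) μ :=
    memLp_one_iff_integrable.1 ((Lp.memLp g).smul (Lp.memLp f).im)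
  rw [L2.inner_def, ← integral_const_mul, ← integral_sub hre (him.const_mul _)]
  refine integral_congr_ae (.of_forall fun x => ?_)
  simp only [RCLike.inner_apply, RCLike.real_smul_eq_coe_mul]
  rw [RCLike.conj_eq_re_sub_im]
  ring

end L2

variable {n : ℕ} {Ω : Set (Space n)}

section TestFunctions

variable {E F : Type*} [NormedAddCommGroup E] [NormedSpace ℝ E] [NormedAddCommGroup F]
  [NormedSpace ℝ F] {φ ψ : Space n → F}

theorem IsTestFunction.differentiable (hφ : IsTestFunction Ω φ) : Differentiable ℝ φ :=
  hφ.1.differentiable (by simp)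

theorem IsTestFunction.memLp (hφ : IsTestFunction Ω φ) : MemLp φ 2 (volume.restrict Ω) :=
  hφ.1.continuous.memLp_of_hasCompactSupport hφ.2.1

theorem IsTestFunction.memLp_partialDeriv (hφ : IsTestFunction Ω φ) (i : Fin n) :
    MemLp (partialDeriv i φ) 2 (volume.restrict Ω) :=
  ((hφ.1.continuous_fderiv (by simp)).clm_apply continuous_const).memLp_of_hasCompactSupport
    (hφ.2.1.fderiv_apply ℝ _)

theorem isTestFunction_zero : IsTestFunction Ω (0 : Space n → F) :=
  ⟨contDiff_const, HasCompactSupport.zero, by simp [tsupport]⟩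

theorem IsTestFunction.add (hφ : IsTestFunction Ω φ) (hψ : IsTestFunction Ω ψ) :
    IsTestFunction Ω (φ + ψ) :=
  ⟨hφ.1.add hψ.1, hφ.2.1.add hψ.2.1,
    (tsupport_add φ ψ).trans (Set.union_subset hφ.2.2 hψ.2.2)⟩

theorem IsTestFunction.clm_comp (hφ : IsTestFunction Ω φ) (T : F →L[ℝ] E) :
    IsTestFunction Ω (fun x => T (φ x)) :=
  ⟨T.contDiff.comp hφ.1, hφ.2.1.comp_left (map_zero T),
    (tsupport_comp_subset (map_zero T) φ).trans hφ.2.2⟩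

theorem partialDeriv_zero (i : Fin n) : partialDeriv i (0 : Space n → F) = 0 := by
  ext x
  simp [partialDeriv]

theorem partialDeriv_add (hφ : Differentiable ℝ φ) (hψ : Differentiable ℝ ψ) (i : Fin n) :
    partialDeriv i (φ + ψ) = partialDeriv i φ + partialDeriv i ψ := by
  ext x
  simp [partialDeriv, fderiv_add (hφ x) (hψ x)]

theorem partialDeriv_clm_comp (hφ : Differentiable ℝ φ) (T : F →L[ℝ] E) (i : Fin n) :
    partialDeriv i (fun x => T (φ x)) = fun x => T (partialDeriv i φ x) := by
  ext x
  have hfderiv : fderiv ℝ (fun x => T (φ x)) x = T.comp (fderiv ℝ φ x) :=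
    (T.hasFDerivAt.comp x (hφ x).hasFDerivAt).fderiv
  simp [partialDeriv, hfderiv]

/-- The graph of the gradient on complex test functions, a subspace of `L² × (L²)ⁿ`; its closure
is the graph of the weak gradient on `H₀¹(Ω)`. -/
def testGraph (Ω : Set (Space n)) : Submodule ℂ (L2 Ω × (Fin n → L2 Ω)) where
  carrier := {p | ∃ φ : Space n → ℂ, IsTestFunction Ω φ ∧ p.1 =ᵐ[volume.restrict Ω] φ ∧
    ∀ i, p.2 i =ᵐ[volume.restrict Ω] partialDeriv i φ}
  zero_mem' := by
    refine ⟨0, isTestFunction_zero, Lp.coeFn_zero _ _ _, fun i => ?_⟩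
    rw [partialDeriv_zero]
    exact Lp.coeFn_zero _ _ _
  add_mem' := by
    rintro p q ⟨φ, hφ, hp, hp'⟩ ⟨ψ, hψ, hq, hq'⟩
    refine ⟨φ + ψ, hφ.add hψ, (Lp.coeFn_add _ _).trans (hp.add hq), fun i => ?_⟩
    rw [partialDeriv_add hφ.differentiable hψ.differentiable]
    exact (Lp.coeFn_add _ _).trans ((hp' i).add (hq' i))
  smul_mem' := by
    rintro c p ⟨φ, hφ, hp, hp'⟩
    let T : ℂ →L[ℝ] ℂ := ContinuousLinearMap.mul ℝ ℂ c
    refine ⟨fun x => T (φ x), hφ.clm_comp T, (Lp.coeFn_smul _ _).trans (hp.const_smul c),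
      fun i => ?_⟩
    rw [partialDeriv_clm_comp hφ.differentiable]
    exact (Lp.coeFn_smul _ _).trans ((hp' i).const_smul c)

theorem IsTestFunction.toLp_mem_testGraph {φ : Space n → ℂ} (hφ : IsTestFunction Ω φ) :
    (hφ.memLp.toLp φ, fun i => (hφ.memLp_partialDeriv i).toLp (partialDeriv i φ)) ∈
      testGraph Ω :=
  ⟨φ, hφ, hφ.memLp.coeFn_toLp, fun i => (hφ.memLp_partialDeriv i).coeFn_toLp⟩

end TestFunctions

section WeakDerivatives

variable {i : Fin n} {u g v k : L2 Ω}

theorem HasWeakPartial.integral_clm_smul (h : HasWeakPartial i u g) (T : ℂ →L[ℝ] ℝ)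
    {p : L2 Ω × (Fin n → L2 Ω)} (hp : p ∈ testGraph Ω) :
    ∫ x in Ω, T (p.2 i x) • u x = -∫ x in Ω, T (p.1 x) • g x := by
  obtain ⟨φ, hφ, hφp, hφp'⟩ := hp
  have hweak := h _ (hφ.clm_comp T)
  rw [partialDeriv_clm_comp hφ.differentiable] at hweak
  calc ∫ x in Ω, T (p.2 i x) • u x = ∫ x in Ω, T (partialDeriv i φ x) • u x :=
        integral_congr_ae ((hφp' i).mono fun x hx => by simp only [hx])
    _ = -∫ x in Ω, T (φ x) • g x := hweak
    _ = -∫ x in Ω, T (p.1 x) • g x :=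
        congrArg _ (integral_congr_ae (hφp.mono fun x hx => by simp only [hx]))

theorem hasWeakPartial_iff_forall_mem_testGraph :
    HasWeakPartial i u g ↔ ∀ p ∈ testGraph Ω, inner ℂ (p.2 i) u = -inner ℂ p.1 g := by
  refine ⟨fun h p hp => ?_, fun h φ hφ => ?_⟩
  · have hre := h.integral_clm_smul Complex.reCLM hp
    have him := h.integral_clm_smul Complex.imCLM hp
    simp only [Complex.reCLM_apply, Complex.imCLM_apply] at hre him
    simp only [inner_eq_integral_re_sub_I_mul_integral_im, RCLike.re_to_complex,
      RCLike.im_to_complex, hre, him]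
    ring
  · have hφℂ := hφ.clm_comp Complex.ofRealCLM
    have hinner := h _ hφℂ.toLp_mem_testGraph
    have hpartial := (hφℂ.memLp_partialDeriv i).coeFn_toLp.trans
      (.of_eq (partialDeriv_clm_comp hφ.differentiable Complex.ofRealCLM i))
    rwa [inner_eq_integral_smul_of_ae_eq_ofReal hpartial,
      inner_eq_integral_smul_of_ae_eq_ofReal hφℂ.memLp.coeFn_toLp] at hinner

theorem HasWeakPartial.smul_add_smul (hu : HasWeakPartial i u g) (hv : HasWeakPartial i v k)
    (a b : ℂ) : HasWeakPartial i (a • u + b • v) (a • g + b • k) := by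
  rw [hasWeakPartial_iff_forall_mem_testGraph] at *
  intro p hp
  simp only [inner_add_right, inner_smul_right, hu p hp, hv p hp]
  ring

theorem HasWeakPartial.star (h : HasWeakPartial i u g) :
    HasWeakPartial i (star u) (star g) := by
  intro φ hφ
  rw [integral_smul_star, integral_smul_star, h φ hφ, star_neg]

end WeakDerivatives

section BoundaryConditions

variable {bc : BoundaryCondition} {u v f g : L2 Ω} {G K : Fin n → L2 Ω}

theorem edist_pi_lt_iff {ι : Type*} [Fintype ι] {X : ι → Type*} [∀ i, PseudoEMetricSpace (X i)]
    {x y : ∀ i, X i} {r : ℝ≥0∞} (hr : 0 < r) : edist x y < r ↔ ∀ i, edist (x i) (y i) < r := by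
  simp [edist_pi_def, Finset.sup_lt_iff (bot_lt_iff_ne_bot.2 hr.ne')]

theorem edist_lt_iff_of_ae_eq {φ : Space n → ℂ} {φ' : Fin n → Space n → ℂ}
    {p : L2 Ω × (Fin n → L2 Ω)} (hφ : p.1 =ᵐ[volume.restrict Ω] φ)
    (hφ' : ∀ i, p.2 i =ᵐ[volume.restrict Ω] φ' i) {ε : ℝ≥0∞} (hε : 0 < ε) :
    edist (u, G) p < ε ↔
      eLpNorm (fun x => φ x - u x) 2 (volume.restrict Ω) < ε ∧
      ∀ i, eLpNorm (fun x => φ' i x - G i x) 2 (volume.restrict Ω) < ε := by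
  rw [edist_comm, Prod.edist_eq, max_lt_iff, edist_pi_lt_iff hε, Lp.edist_def,
    eLpNorm_congr_ae (hφ.sub .rfl)]
  refine and_congr .rfl (forall_congr' fun i => ?_)
  rw [Lp.edist_def, eLpNorm_congr_ae ((hφ' i).sub .rfl)]
  rfl

theorem inH10_iff_mem_topologicalClosure :
    InH10 u G ↔ (u, G) ∈ (testGraph Ω).topologicalClosure := by
  rw [← SetLike.mem_coe, Submodule.topologicalClosure_coe, EMetric.mem_closure_iff]
  refine forall₂_congr fun ε hε => ⟨?_, ?_⟩
  · rintro ⟨φ, hφ, hclose⟩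
    exact ⟨_, hφ.toLp_mem_testGraph, (edist_lt_iff_of_ae_eq hφ.memLp.coeFn_toLp
      (fun i => (hφ.memLp_partialDeriv i).coeFn_toLp) hε).2 hclose⟩
  · rintro ⟨p, ⟨φ, hφ, hp, hp'⟩, hclose⟩
    exact ⟨φ, hφ, (edist_lt_iff_of_ae_eq hp hp' hε).1 hclose⟩

theorem BoundaryCondition.Holds.smul_add_smul (hu : bc.Holds u G f) (hv : bc.Holds v K g)
    (a b : ℂ) : bc.Holds (a • u + b • v) (a • G + b • K) (a • f + b • g) := by
  cases bc with
  | dirichlet =>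
    simp only [Holds, inH10_iff_mem_topologicalClosure] at *
    exact add_mem (Submodule.smul_mem _ a hu) (Submodule.smul_mem _ b hv)
  | neumann =>
    intro w W hw
    have hu_green := hu w W hw
    have hv_green := hv w W hw
    simp only [integral_mul_eq_inner_star, Pi.add_apply, Pi.smul_apply, inner_add_right,
      inner_smul_right, Finset.sum_add_distrib, ← Finset.mul_sum] at *
    linear_combination a * hu_green + b * hv_green

theorem InH10.inner_sum_add_sum_inner_eq_zero {H : Fin n → Fin n → L2 Ω} (hu : InH10 u G)
    (hH : ∀ i, HasWeakGradient (K i) (H i)) :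
    inner ℂ u (∑ i, H i i) + ∑ i, inner ℂ (G i) (K i) = 0 := by
  have hclosed : IsClosed {p : L2 Ω × (Fin n → L2 Ω) |
      inner ℂ p.1 (∑ i, H i i) + ∑ i, inner ℂ (p.2 i) (K i) = 0} :=
    isClosed_eq (by fun_prop) continuous_const
  refine closure_minimal (fun p hp => ?_) hclosed (inH10_iff_mem_topologicalClosure.1 hu)
  simp only [Set.mem_ofPred_eq, inner_sum, ← Finset.sum_add_distrib]
  refine Finset.sum_eq_zero fun i _ => ?_
  rw [hasWeakPartial_iff_forall_mem_testGraph.1 (hH i i) p hp, add_neg_cancel]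

end BoundaryConditions

section Laplacian

variable {bc : BoundaryCondition} {u v f g : L2 Ω} {G : Fin n → L2 Ω}

theorem HasLaplacian.smul_add_smul (hu : HasLaplacian bc u f) (hv : HasLaplacian bc v g)
    (a b : ℂ) : HasLaplacian bc (a • u + b • v) (a • f + b • g) := by
  obtain ⟨G, H, hG, hH, rfl, hbc⟩ := hu
  obtain ⟨G', H', hG', hH', rfl, hbc'⟩ := hv
  refine ⟨a • G + b • G', a • H + b • H', fun i => (hG i).smul_add_smul (hG' i) a b,
    fun i j => (hH i j).smul_add_smul (hH' i j) a b, ?_, hbc.smul_add_smul hbc' a b⟩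
  simp [Finset.sum_add_distrib, Finset.smul_sum]

theorem HasLaplacian.smul (hu : HasLaplacian bc u f) (a : ℂ) :
    HasLaplacian bc (a • u) (a • f) := by
  simpa using hu.smul_add_smul hu a 0

theorem hasLaplacian_zero : HasLaplacian bc (0 : L2 Ω) 0 := by
  have hweak (i : Fin n) : HasWeakPartial i (0 : L2 Ω) 0 :=
    hasWeakPartial_iff_forall_mem_testGraph.2 fun p _ => by simp only [inner_zero_right, neg_zero]
  refine ⟨0, 0, hweak, fun _ => hweak, by simp, ?_⟩
  cases bc with
  | dirichlet => exact inH10_iff_mem_topologicalClosure.2 (zero_mem _)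
  | neumann =>
    intro w W _
    simp only [integral_mul_eq_inner_star, Pi.zero_apply, inner_zero_right, Finset.sum_const_zero,
      add_zero]

theorem HasLaplacian.sum_smul {ι : Type*} {U V : ι → L2 Ω} (h : ∀ i, HasLaplacian bc (U i) (V i))
    (c : ι → ℂ) (s : Finset ι) : HasLaplacian bc (∑ i ∈ s, c i • U i) (∑ i ∈ s, c i • V i) := by
  classical
  induction s using Finset.induction_on with
  | empty => simpa using hasLaplacian_zero
  | insert i s hi ih =>
    simpa only [Finset.sum_insert hi, one_smul] using (h i).smul_add_smul ih (c i) 1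

open scoped ComplexOrder in
theorem HasLaplacian.inner_nonpos (h : HasLaplacian bc u f) : inner ℂ u f ≤ 0 := by
  obtain ⟨G, H, hG, hH, rfl, hbc⟩ := h
  have hgreen : inner ℂ u (∑ i, H i i) + ∑ i, inner ℂ (G i) (G i) = 0 := by
    cases bc with
    | dirichlet => exact hbc.inner_sum_add_sum_inner_eq_zero hH
    | neumann =>
      simpa only [integral_mul_eq_inner_star, star_star] using
        hbc (star u) (fun i => star (G i)) fun i => (hG i).star
  rw [eq_neg_of_add_eq_zero_left hgreen, neg_nonpos]
  refine Finset.sum_nonneg fun i _ => ?_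
  rw [inner_self_eq_norm_sq_to_K]
  exact pow_nonneg (Complex.zero_le_real.2 (norm_nonneg (G i))) 2

open scoped ComplexOrder in
theorem HasLaplacian.eigenvalue_nonpos {μ : ℂ} (h : HasLaplacian bc u (μ • u)) (hu : u ≠ 0) :
    μ ≤ 0 := by
  have hpos : 0 < inner ℂ u u := by
    rw [inner_self_eq_norm_sq_to_K]
    exact pow_pos (Complex.zero_lt_real.2 (norm_pos_iff.2 hu)) 2
  refine le_of_mul_le_mul_right ?_ hpos
  rw [← inner_smul_right, zero_mul]
  exact h.inner_nonpos

theorem isEigenvalueNegLaplacian_iff {l : ℝ} :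
    IsEigenvalueNegLaplacian Ω bc l ↔ ∃ w : L2 Ω, w ≠ 0 ∧ HasLaplacian bc w (-(l : ℂ) • w) := by
  constructor
  · rintro ⟨w, Δw, hw, hΔ, heq⟩
    exact ⟨w, hw, by rwa [neg_smul, ← heq, neg_neg]⟩
  · rintro ⟨w, hw, hΔ⟩
    exact ⟨w, _, hw, hΔ, by rw [neg_smul, neg_neg]⟩

theorem IsEigenvalueNegLaplacian.nonneg {l : ℝ} (hl : IsEigenvalueNegLaplacian Ω bc l) :
    0 ≤ l := by
  obtain ⟨w, hw, hΔ⟩ := isEigenvalueNegLaplacian_iff.1 hl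
  simpa using (Complex.nonpos_iff.1 (hΔ.eigenvalue_nonpos hw)).1

theorem HasLaplacian.exists_isEigenvalueNegLaplacian {μ : ℂ} (h : HasLaplacian bc u (μ • u))
    (hu : u ≠ 0) : ∃ l : ℝ, μ = -(l : ℂ) ∧ IsEigenvalueNegLaplacian Ω bc l := by
  have hμ : μ = -((-μ.re : ℝ) : ℂ) := by
    have him := (Complex.nonpos_iff.1 (h.eigenvalue_nonpos hu)).2
    exact Complex.ext (by simp) (by simp [him])
  exact ⟨-μ.re, hμ, isEigenvalueNegLaplacian_iff.2 ⟨u, hu, hμ ▸ h⟩⟩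

open Module.End in
theorem exists_hasEigenvalue_neg_of_hasLaplacian {ι : Type*} [Fintype ι] [DecidableEq ι]
    {U : ι → L2 Ω} (hU : U ≠ 0) {M : Matrix ι ι ℂ}
    (hM : ∀ i, HasLaplacian bc (U i) (∑ j, M i j • U j)) :
    ∃ l : ℝ, IsEigenvalueNegLaplacian Ω bc l ∧ HasEigenvalue (Matrix.toLin' M) (-(l : ℂ)) := by
  let T : (ι → ℂ) →ₗ[ℂ] L2 Ω := Fintype.linearCombination ℂ U
  have hT : T ≠ 0 := by
    contrapose! hU
    ext1 i
    simpa [T] using LinearMap.congr_fun hU (Pi.single i 1)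
  have hTM (c : ι → ℂ) : T (Matrix.toLin' M.transpose c) = ∑ i, c i • ∑ j, M i j • U j := by
    simp only [T, Fintype.linearCombination_apply, Matrix.toLin'_apply, Matrix.mulVec, dotProduct,
      Matrix.transpose_apply, Finset.sum_smul, Finset.smul_sum, smul_smul]
    rw [Finset.sum_comm]
    simp only [mul_comm]
  obtain ⟨μ, c, hμ, hTc, hTμ⟩ :=
    exists_hasEigenvalue_map_apply_eq_smul hT (Matrix.toLin' M.transpose)
  have hΔ : HasLaplacian bc (T c) (μ • T c) := by
    rw [← hTμ, hTM]
    exact .sum_smul hM c Finset.univ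
  obtain ⟨l, rfl, hl⟩ := hΔ.exists_isEigenvalueNegLaplacian hTc
  refine ⟨l, hl, ?_⟩
  rwa [hasEigenvalue_iff_isRoot_charpoly, Matrix.charpoly_toLin', Matrix.charpoly_transpose,
    ← Matrix.charpoly_toLin', ← hasEigenvalue_iff_isRoot_charpoly] at hμ

end Laplacian

end TuringSystem

namespace ReactionDiffusionSystem

open TuringSystem
open Module.End (HasEigenvalue)

variable {n : ℕ} {S : ReactionDiffusionSystem n}

variable (S) in
/-- The linearization of the system restricted to an eigenspace of `-Δ` with eigenvalue `l`: the
matrix `A - l diag(D_u, D_v)`. -/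
noncomputable def modeMatrix (l : ℝ) : Matrix (Fin 2) (Fin 2) ℝ :=
  S.A - l • Matrix.diagonal ![S.Du, S.Dv]

theorem trace_modeMatrix (l : ℝ) : (S.modeMatrix l).trace = S.A.trace - l * (S.Du + S.Dv) := by
  simp [modeMatrix, Matrix.trace_fin_two]

theorem det_modeMatrix (l : ℝ) :
    (S.modeMatrix l).det =
      S.Du * S.Dv * l ^ 2 - (S.Dv * S.A 0 0 + S.Du * S.A 1 1) * l + S.A.det := by
  simp [modeMatrix, Matrix.det_fin_two]
  ring

theorem det_modeMatrix_eq_mul_sq_sub {D L : ℝ} (hD : D = S.Dv * S.A 0 0 + S.Du * S.A 1 1)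
    (hL : L = -S.A.det / (S.Du * S.Dv) + D ^ 2 / (4 * S.Du ^ 2 * S.Dv ^ 2)) (l : ℝ) :
    (S.modeMatrix l).det = S.Du * S.Dv * ((l - D / (2 * S.Du * S.Dv)) ^ 2 - L) := by
  have hDu := S.Du_pos.ne'
  have hDv := S.Dv_pos.ne'
  rw [det_modeMatrix, ← hD, hL]
  field

theorem trace_modeMatrix_neg (htr : S.A.trace < 0) {l : ℝ} (hl : 0 ≤ l) :
    (S.modeMatrix l).trace < 0 := by
  have hdiff : 0 ≤ l * (S.Du + S.Dv) := mul_nonneg hl (add_pos S.Du_pos S.Dv_pos).le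
  rw [trace_modeMatrix]
  linarith

theorem det_modeMatrix_pos_of_nonpos (hdet : 0 < S.A.det)
    (hD : S.Dv * S.A 0 0 + S.Du * S.A 1 1 ≤ 0) {l : ℝ} (hl : 0 ≤ l) :
    0 < (S.modeMatrix l).det := by
  have hquad : 0 ≤ S.Du * S.Dv * l ^ 2 :=
    mul_nonneg (mul_pos S.Du_pos S.Dv_pos).le (sq_nonneg l)
  have hlin : (S.Dv * S.A 0 0 + S.Du * S.A 1 1) * l ≤ 0 := mul_nonpos_of_nonpos_of_nonneg hD hl
  rw [det_modeMatrix]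
  linarith

theorem IsEigenvalue.exists_hasEigenvalue_modeMatrix {β : ℂ} (hβ : S.IsEigenvalue β) :
    ∃ l : ℝ, IsEigenvalueNegLaplacian S.Ω S.bc l ∧
      HasEigenvalue (Matrix.toLin' ((S.modeMatrix l).map Complex.ofReal)) β := by
  obtain ⟨u, v, Δu, Δv, huv, hu, hv, hequ, heqv⟩ := hβ
  have hDu : (S.Du : ℂ) ≠ 0 := by exact_mod_cast S.Du_pos.ne'
  have hDv : (S.Dv : ℂ) ≠ 0 := by exact_mod_cast S.Dv_pos.ne'
  let M : Matrix (Fin 2) (Fin 2) ℂ :=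
    !![(β - S.A 0 0) / S.Du, -S.A 0 1 / S.Du; -S.A 1 0 / S.Dv, (β - S.A 1 1) / S.Dv]
  have hΔu : Δu = M 0 0 • u + M 0 1 • v := by
    change Δu = ((β - S.A 0 0) / S.Du : ℂ) • u + (-S.A 0 1 / S.Du : ℂ) • v
    linear_combination (norm := (match_scalars <;> field)) (S.Du : ℂ)⁻¹ • hequ
  have hΔv : Δv = M 1 0 • u + M 1 1 • v := by
    change Δv = (-S.A 1 0 / S.Dv : ℂ) • u + ((β - S.A 1 1) / S.Dv : ℂ) • v
    linear_combination (norm := (match_scalars <;> field)) (S.Dv : ℂ)⁻¹ • heqv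
  have hUV : ![u, v] ≠ 0 := by
    contrapose! huv
    exact ⟨congrFun huv 0, congrFun huv 1⟩
  have hM (i : Fin 2) : HasLaplacian S.bc (![u, v] i) (∑ j, M i j • ![u, v] j) := by
    rw [Fin.sum_univ_two]
    fin_cases i
    exacts [hΔu ▸ hu, hΔv ▸ hv]
  obtain ⟨l, hl, hMl⟩ := exists_hasEigenvalue_neg_of_hasLaplacian hUV hM
  refine ⟨l, hl, ?_⟩
  rw [hasEigenvalue_toLin'_fin_two_iff, Matrix.trace_fin_two_of, Matrix.det_fin_two_of] at hMl
  rw [hasEigenvalue_map_ofReal_iff, trace_modeMatrix, det_modeMatrix, Matrix.trace_fin_two,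
    Matrix.det_fin_two]
  push_cast
  linear_combination (norm := field) S.Du * S.Dv * hMl

theorem isEigenvalue_of_hasEigenvalue_modeMatrix {l : ℝ}
    (hl : IsEigenvalueNegLaplacian S.Ω S.bc l) {β : ℂ}
    (hβ : HasEigenvalue (Matrix.toLin' ((S.modeMatrix l).map Complex.ofReal)) β) :
    S.IsEigenvalue β := by
  obtain ⟨w, hw, hΔ⟩ := isEigenvalueNegLaplacian_iff.1 hl
  obtain ⟨c, hc⟩ := hβ.exists_hasEigenvector
  have hcu : (S.A 0 0 - l * S.Du) * c 0 + S.A 0 1 * c 1 = β * c 0 := by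
    simpa [modeMatrix, Matrix.mulVec, dotProduct] using congrFun hc.apply_eq_smul 0
  have hcv : S.A 1 0 * c 0 + (S.A 1 1 - l * S.Dv) * c 1 = β * c 1 := by
    simpa [modeMatrix, Matrix.mulVec, dotProduct] using congrFun hc.apply_eq_smul 1
  refine ⟨c 0 • w, c 1 • w, _, _, ?_, hΔ.smul (c 0), hΔ.smul (c 1), ?_, ?_⟩
  · by_contra! hzero
    refine hc.2 (funext (Fin.forall_fin_two.2 ⟨?_, ?_⟩))
    exacts [(smul_eq_zero.1 hzero.1).resolve_right hw, (smul_eq_zero.1 hzero.2).resolve_right hw]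
  · linear_combination (norm := module) hcu • w
  · linear_combination (norm := module) hcv • w

theorem turingStable_of_det_modeMatrix_pos (htr : S.A.trace < 0)
    (hdet : ∀ l, IsEigenvalueNegLaplacian S.Ω S.bc l → 0 < (S.modeMatrix l).det) :
    S.TuringStable := by
  intro β hβ
  obtain ⟨l, hl, hlβ⟩ := hβ.exists_hasEigenvalue_modeMatrix
  exact re_neg_of_hasEigenvalue (trace_modeMatrix_neg htr hl.nonneg) (hdet l hl) hlβ

theorem turingUnstable_iff_exists_det_modeMatrix_neg (hdet : 0 < S.A.det) (htr : S.A.trace < 0) :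
    S.TuringUnstable ↔
      ∃ l : ℝ, IsEigenvalueNegLaplacian S.Ω S.bc l ∧ (S.modeMatrix l).det < 0 := by
  have hkin : S.KineticallyStable := fun _ => re_neg_of_hasEigenvalue htr hdet
  have hmode {l : ℝ} (hl : IsEigenvalueNegLaplacian S.Ω S.bc l) :=
    exists_hasEigenvalue_re_pos_iff (trace_modeMatrix_neg htr hl.nonneg)
  constructor
  · rintro ⟨-, β, hβ, hre⟩
    obtain ⟨l, hl, hlβ⟩ := hβ.exists_hasEigenvalue_modeMatrix
    exact ⟨l, hl, (hmode hl).1 ⟨β, hlβ, hre⟩⟩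
  · rintro ⟨l, hl, hneg⟩
    obtain ⟨β, hlβ, hre⟩ := (hmode hl).2 hneg
    exact ⟨hkin, β, isEigenvalue_of_hasEigenvalue_modeMatrix hl hlβ, hre⟩

end ReactionDiffusionSystem

theorem theorem4p1_general {n : ℕ} (S : ReactionDiffusionSystem n)
    (hdet : 0 < S.A.det) (htr : S.A.trace < 0) (D L : ℝ)
    (hD : D = S.Dv * S.A 0 0 + S.Du * S.A 1 1)
    (hL : L = -S.A.det / (S.Du * S.Dv) + D ^ 2 / (4 * S.Du ^ 2 * S.Dv ^ 2)) :
    (D ≤ 0 ∨ L < 0 → S.TuringStable) ∧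
    (S.TuringUnstable ↔
      ∃ l : ℝ, TuringSystem.IsEigenvalueNegLaplacian S.Ω S.bc l ∧
        (l - D / (2 * S.Du * S.Dv)) ^ 2 < L) := by
  have hDuDv : 0 < S.Du * S.Dv := mul_pos S.Du_pos S.Dv_pos
  have hmode := S.det_modeMatrix_eq_mul_sq_sub hD hL
  constructor
  · refine fun hDL => S.turingStable_of_det_modeMatrix_pos htr fun l hl => ?_
    rcases hDL with hD0 | hL0
    · exact S.det_modeMatrix_pos_of_nonpos hdet (hD ▸ hD0) hl.nonneg
    · rw [hmode]
      exact mul_pos hDuDv (sub_pos.2 (hL0.trans_le (sq_nonneg _)))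
  · have hneg (l : ℝ) :
        (S.modeMatrix l).det < 0 ↔ (l - D / (2 * S.Du * S.Dv)) ^ 2 < L := by
      rw [hmode, ← smul_eq_mul, smul_neg_iff_of_pos_left hDuDv, sub_neg]
    simp only [S.turingUnstable_iff_exists_det_modeMatrix_neg hdet htr, hneg]

theorem theorem4p1 {n : ℕ} (S : ReactionDiffusionSystem n)
    (hdet : 0 < S.A.det) (htr : S.A.trace < 0) (D L : ℝ)
    (hD : D = S.Dv * S.A 0 0 + S.Du * S.A 1 1)
    (hL : L = -S.A.det / (S.Du * S.Dv) + D ^ 2 / (4 * S.Du ^ 2 * S.Dv ^ 2)) :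
    (D ≤ 0 → L ≤ 0 → S.TuringStable) ∧
    (0 < L → (S.TuringUnstable ↔
      ∃ l : ℝ, TuringSystem.IsEigenvalueNegLaplacian S.Ω S.bc l ∧
        |l - D / (2 * S.Du * S.Dv)| < √L)) := by
  simp only [Real.lt_sqrt (abs_nonneg _), sq_abs]
  exact (theorem4p1_general S hdet htr D L hD hL).imp (fun h hD0 _ => h (.inl hD0)) fun h _ => h
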